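/- **Setting.** A *spacetime* $M$ is a smooth (Hausdorff, second countable) manifold of dimension $N\ge 2$ with a smooth Lorentzian metric of signature $(-,+,\dots,+)$ and a time orientation. Write $p\ll q$ if there is a future-directed (piecewise smooth) timelike curve from $p$ to $q$; $I^-(p)=\{q: q\ll p\}$, $I^+(p)=\{q:p\ll q\}$, $I^\pm[A]=\bigcup_{p\in A}I^\pm(p)$. $M$ is assumed *strongly causal*: every neighbourhood $U$ of any point $p$ contains a neighbourhood $V$ of $p$ such that every causal curve with endpoints in $V$ lies in $U$. A set $P\subset M$ is a *past set* if $I^-[P]=P$; a non-empty past set which is not the union of two proper subsets that are both past sets is an *IP*; an IP not of the form $I^-(p)$ is a *TIP*. *Future sets*, *IFs*, *TIFs* are defined dually. Put $\uparrow P=I^+[\{q: p\ll q\ \forall p\in P\}]$ and $\downarrow F=I^-[\{q: q\ll p\ \forall p\in F\}]$. An IP $P$ and an IF $F$ satisfy $P\sim_S F$ if $F$ is a maximal IF contained in $\uparrow P$ and $P$ is a maximal IP contained in $\downarrow F$. Moreover $P\sim_S\emptyset$ (resp. $\emptyset\sim_S F$) if the IP $P$ (resp. the IF $F$) is not S-related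 in this sense to any IF (resp. IP). An *admissible completion as a point set* is a set $\overline M$ of pairs $(P,F)$ (each of $P,F$ being indecomposable or empty) with $P\sim_S F$, which contains all pairs $(I^-(p),I^+(p))$, $p\in M$ (identified with $p$), and such that every TIP and every TIF is a component of some pair in $\overline M\setminus M$. The chronological relation on $\overline M$ is $(P,F)\,\overline\ll\,(P',F')\iff F\cap P'\ne\emptyset$, and $I^\pm(x,\overline M)$ denotes the future/past of $x\in M$ for it. For a sequence $\sigma=\{(P_n,F_n)\}$ in $\overline M$, let $(P,F)\in L(\sigma)$ iff: if $P\neq\emptyset$, then $P\subset \mathrm{LI}(P_n)$ and $P$ is a maximal IP in $\mathrm{LS}(P_n)$; and if $F\ne\emptyset$, then $F\subset \mathrm{LI}(F_n)$ and $F$ is a maximal IF in $\mathrm{LS}(F_n)$ (set-theoretic lower and upper limits). The *chr. topology* on $\overline M$ is the one in which $C$ is closed iff $L(\sigma)\subset C$ for every sequence $\sigma$ in $C$; $\overline M$ with $\overline\ll$ and this topology is a *standard completion*. The chr. topology is *of first order* if $\sigma\to(P,F)$ implies $(P,F)\in L(\sigma)$. It is *separating* if for any pairs $(P,F),(P',\emptyset)\in\overline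 M$ with $P'\subsetneq P$ there is $x\in P\setminus\overline{P'}$ (closure in $M$) with $(P,F)\in I^+(x,\overline M)$ and $(P',\emptyset)\notin\overline{I^+(x,\overline M)}$ (closure in $\overline M$), and dually for pairs $(P,F),(\emptyset,F')$ with $F'\subsetneq F$. **Proposition.** Assume that the chr. topology of a standard completion $\overline M$ of a strongly causal spacetime $M$ is separating. Then it is of first order and second countable. Moreover, for any $D=\{x_n\}_{n\in\mathbb N}\subset M$ which is dense in $M$ and chronologically dense in $M$ (i.e. $p\ll q$ implies $p\ll x_n\ll q$ for some $n$), $D$ is dense in $\overline M$ and the set $$\Omega=\{I^{+}(x_{m},\overline M)\cap I^{-}(x_{n},\overline M): m,n\in\mathbb N\}\ \cup\ \Big\{I^{\pm}(x_{n},\overline M)\cap\Big(\overline M\setminus\overline{\textstyle\bigcup_{i=1}^{k}I^{\pm}(x_{j_i},\overline M)}\Big): n,j_1,\dots,j_k\in\mathbb N,\ k\ge 0\Big\}$$ (the same sign at both places of $\pm$; the union is empty for $k=0$) is a topological basis of the chr. topology. -/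

import Mathlib

open Set Filter Topology Manifold ContDiff Bundle

namespace CausalBoundary

/-! ## Spacetimes and their chronological relation -/

section Spacetimes

variable (n : ℕ) (M : Type*) [TopologicalSpace M] [ChartedSpace (EuclideanSpace ℝ (Fin n)) M]
  [IsManifold (𝓡 n) ∞ M]

/-- A smooth Lorentzian metric, of signature `(-, +, …, +)`: at every point there is a vector of
negative square whose orthogonal complement is positive definite. -/
structure LorentzianMetric where
  inner (p : M) : TangentSpace (𝓡 n) p →L[ℝ] TangentSpace (𝓡 n) p →L[ℝ] ℝ
  symm (p : M) (v w : TangentSpace (𝓡 n) p) : inner p v w = inner p w v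
  signature (p : M) : ∃ v : TangentSpace (𝓡 n) p, inner p v v < 0 ∧
    ∀ w : TangentSpace (𝓡 n) p, inner p v w = 0 → w ≠ 0 → 0 < inner p w w
  contMDiff : ContMDiff (𝓡 n)
    ((𝓡 n).prod 𝓘(ℝ, EuclideanSpace ℝ (Fin n) →L[ℝ] EuclideanSpace ℝ (Fin n) →L[ℝ] ℝ)) ∞
    (fun p ↦ TotalSpace.mk' (EuclideanSpace ℝ (Fin n) →L[ℝ] EuclideanSpace ℝ (Fin n) →L[ℝ] ℝ)
      (E := fun p : M ↦ TangentSpace (𝓡 n) p →L[ℝ] TangentSpace (𝓡 n) p →L[ℝ] ℝ) p (inner p))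

/-- A time-oriented Lorentzian manifold; the time orientation is given by a smooth timelike
vector field, which is declared to be future-directed. -/
structure Spacetime extends LorentzianMetric n M where
  timeField (p : M) : TangentSpace (𝓡 n) p
  timeField_timelike (p : M) : inner p (timeField p) (timeField p) < 0
  contMDiff_timeField : ContMDiff (𝓡 n) (𝓡 n).tangent ∞
    (fun p ↦ (⟨p, timeField p⟩ : TangentBundle (𝓡 n) M))

end Spacetimes

section Curves

variable {n : ℕ} {M : Type*} [TopologicalSpace M] [ChartedSpace (EuclideanSpace ℝ (Fin n)) M]
  [IsManifold (𝓡 n) ∞ M]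

namespace Spacetime

/-- `v` is a future-directed timelike vector. -/
def IsFutureTimelike (S : Spacetime n M) (p : M) (v : TangentSpace (𝓡 n) p) : Prop :=
  S.inner p v v < 0 ∧ S.inner p (S.timeField p) v < 0

/-- `v` is a future-directed causal vector, i.e. timelike or lightlike (in particular non-zero). -/
def IsFutureCausal (S : Spacetime n M) (p : M) (v : TangentSpace (𝓡 n) p) : Prop :=
  v ≠ 0 ∧ S.inner p v v ≤ 0 ∧ S.inner p (S.timeField p) v < 0

end Spacetime

/-- `γ`, restricted to `[a, b]` with `a < b`, is a smooth curve all of whose velocities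
(one-sided at `a` and `b`) lie in the cone field `K`. -/
def IsSmoothArc (K : ∀ p : M, TangentSpace (𝓡 n) p → Prop) (γ : ℝ → M) (a b : ℝ) : Prop :=
  a < b ∧ ContMDiffOn 𝓘(ℝ, ℝ) (𝓡 n) ∞ γ (Icc a b) ∧
    ∀ t ∈ Icc a b, K (γ t) (mfderivWithin 𝓘(ℝ, ℝ) (𝓡 n) γ (Icc a b) t (1 : ℝ))

/-- `IsPiecewiseCurve K p q A`: there is a piecewise smooth curve from `p` to `q` with velocities
in the cone field `K` and with image `A`, i.e. a finite concatenation of smooth arcs. -/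
inductive IsPiecewiseCurve (K : ∀ p : M, TangentSpace (𝓡 n) p → Prop) : M → M → Set M → Prop
  | arc (γ : ℝ → M) (a b : ℝ) (h : IsSmoothArc K γ a b) :
      IsPiecewiseCurve K (γ a) (γ b) (γ '' Icc a b)
  | concat (p q r : M) (A B : Set M) (h₁ : IsPiecewiseCurve K p q A)
      (h₂ : IsPiecewiseCurve K q r B) : IsPiecewiseCurve K p r (A ∪ B)

namespace Spacetime

/-- The chronological relation `p ≪ q`: some future-directed timelike curve runs from `p` to
`q`. -/
def Chron (S : Spacetime n M) (p q : M) : Prop :=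
  ∃ A : Set M, IsPiecewiseCurve S.IsFutureTimelike p q A

/-- Strong causality: every neighbourhood `U` of any point `p` contains a neighbourhood `V` of `p`
such that every causal curve with endpoints in `V` lies entirely in `U`. -/
def StronglyCausal (S : Spacetime n M) : Prop :=
  ∀ p : M, ∀ U ∈ 𝓝 p, ∃ V ∈ 𝓝 p, V ⊆ U ∧
    ∀ x ∈ V, ∀ y ∈ V, ∀ A : Set M, IsPiecewiseCurve S.IsFutureCausal x y A → A ⊆ U

end Spacetime

end Curves

/-! ## Indecomposable sets and the S-relation

These notions depend only on the chronological relation `r` on `X`. Passing from pasts to futures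
is passing from `r` to `flip r`. -/

section Indecomposable

variable {X : Type*} (r : X → X → Prop)

/-- `I⁻(x)`. -/
def pointPast (x : X) : Set X := {p | r p x}

/-- `I⁺(x)`. -/
def pointFuture (x : X) : Set X := {p | r x p}

/-- `I⁻[A]`. -/
def setPast (A : Set X) : Set X := {p | ∃ q ∈ A, r p q}

/-- A past set: one that coincides with its past. -/
def IsPastSet (P : Set X) : Prop := setPast r P = P

/-- A (non-empty) indecomposable past set. -/
def IsIP (P : Set X) : Prop :=
  P.Nonempty ∧ IsPastSet r P ∧
    ¬ ∃ A B : Set X, A ⊂ P ∧ B ⊂ P ∧ IsPastSet r A ∧ IsPastSet r B ∧ P = A ∪ B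

/-- A (non-empty) indecomposable future set. -/
def IsIF (F : Set X) : Prop := IsIP (flip r) F

/-- A terminal indecomposable past set: an IP which is not the past of a point. -/
def IsTIP (P : Set X) : Prop := IsIP r P ∧ ∀ x, P ≠ pointPast r x

/-- A terminal indecomposable future set: an IF which is not the future of a point. -/
def IsTIF (F : Set X) : Prop := IsIF r F ∧ ∀ x, F ≠ pointFuture r x

/-- The common past `↓A = I⁻[{p | p ≪ q for all q ∈ A}]`. -/
def commonPast (A : Set X) : Set X := setPast r {p | ∀ q ∈ A, r p q}

/-- The common future `↑A = I⁺[{p | q ≪ p for all q ∈ A}]`. -/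
def commonFuture (A : Set X) : Set X := commonPast (flip r) A

/-- `P` is a maximal element, for inclusion, among the IPs contained in `A`. -/
def IsMaximalIPIn (A P : Set X) : Prop := Maximal (fun Q ↦ IsIP r Q ∧ Q ⊆ A) P

/-- `F` is a maximal element, for inclusion, among the IFs contained in `A`. -/
def IsMaximalIFIn (A F : Set X) : Prop := Maximal (fun Q ↦ IsIF r Q ∧ Q ⊆ A) F

/-- The S-relation between an IP `P` and an IF `F`. -/
def SRelatedNonempty (P F : Set X) : Prop :=
  IsMaximalIFIn r (commonFuture r P) F ∧ IsMaximalIPIn r (commonPast r F) P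

/-- The S-relation `P ∼_S F`, where each of `P` and `F` is indecomposable or empty, but not both
are empty. -/
def SRelated (P F : Set X) : Prop :=
  (IsIP r P ∧ IsIF r F ∧ SRelatedNonempty r P F) ∨
  (IsIP r P ∧ F = ∅ ∧ ∀ F', IsIF r F' → ¬ SRelatedNonempty r P F') ∨
  (P = ∅ ∧ IsIF r F ∧ ∀ P', IsIP r P' → ¬ SRelatedNonempty r P' F)

/-- A set `D` is chronologically dense if `x ≪ y` implies `x ≪ s ≪ y` for some `s ∈ D`. -/
def ChronDense (D : Set X) : Prop := ∀ x y, r x y → ∃ s ∈ D, r x s ∧ r s y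

/-- The pair `(I⁻(p), I⁺(p))` with which the point `p` is identified. -/
def pointPair (p : X) : Set X × Set X := (pointPast r p, pointFuture r p)

/-- An admissible completion as a point set: a set of pairs `(P, F)` with `P ∼_S F` (so that each
of `P`, `F` is indecomposable or empty) which contains the pairs of all points, and such that every
TIP and every TIF is a component of some pair that is not the pair of a point. -/
structure AdmissibleCompletion where
  carrier : Set (Set X × Set X)
  pointPair_mem (p : X) : pointPair r p ∈ carrier
  exists_of_isTIP (P : Set X) : IsTIP r P → ∃ x ∈ carrier \ range (pointPair r), x.1 = P
  exists_of_isTIF (F : Set X) : IsTIF r F → ∃ x ∈ carrier \ range (pointPair r), x.2 = F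
  sRelated (x : Set X × Set X) : x ∈ carrier → SRelated r x.1 x.2

end Indecomposable

/-! ## The limit operator and the chronological topology -/

section Limits

variable {X : Type*}

/-- The lower limit of a sequence of sets. -/
def setLI (A : ℕ → Set X) : Set X := {x | ∀ᶠ n in atTop, x ∈ A n}

/-- The upper limit of a sequence of sets. -/
def setLS (A : ℕ → Set X) : Set X := {x | ∃ᶠ n in atTop, x ∈ A n}

/-- `P ∈ L̂(Pₙ)`. -/
def LHat (r : X → X → Prop) (A : ℕ → Set X) (P : Set X) : Prop :=
  P ⊆ setLI A ∧ IsMaximalIPIn r (setLS A) P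

/-- `F ∈ Ľ(Fₙ)`. -/
def LCheck (r : X → X → Prop) (A : ℕ → Set X) (F : Set X) : Prop :=
  F ⊆ setLI A ∧ IsMaximalIFIn r (setLS A) F

theorem LHat.comp {r : X → X → Prop} {A : ℕ → Set X} {P : Set X} (h : LHat r A P) {u : ℕ → ℕ}
    (hu : StrictMono u) : LHat r (A ∘ u) P := by
  have hLI : P ⊆ setLI (A ∘ u) := fun x hx ↦ hu.tendsto_atTop.eventually (h.1 hx)
  have hLS : setLS (A ∘ u) ⊆ setLS A := fun x hx ↦ hu.tendsto_atTop.frequently hx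
  refine ⟨hLI, ⟨⟨h.2.prop.1, fun x hx ↦ (hLI hx : ∀ᶠ n in atTop, _).frequently⟩, ?_⟩⟩
  intro Q hQ hPQ
  exact h.2.le_of_ge ⟨hQ.1, hQ.2.trans hLS⟩ hPQ

theorem LCheck.comp {r : X → X → Prop} {A : ℕ → Set X} {F : Set X} (h : LCheck r A F) {u : ℕ → ℕ}
    (hu : StrictMono u) : LCheck r (A ∘ u) F :=
  LHat.comp (r := flip r) h hu

namespace AdmissibleCompletion

variable {r : X → X → Prop}

/-- The space of all points `(P, F)` of the completion. -/
def Point (C : AdmissibleCompletion r) : Type _ := C.carrier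

variable (C : AdmissibleCompletion r)

/-- The past component `P` of `(P, F)`. -/
def Point.pst {C : AdmissibleCompletion r} (x : C.Point) : Set X := x.1.1

/-- The future component `F` of `(P, F)`. -/
def Point.fut {C : AdmissibleCompletion r} (x : C.Point) : Set X := x.1.2

/-- The inclusion `p ↦ (I⁻(p), I⁺(p))`. -/
def incl (p : X) : C.Point := ⟨pointPair r p, C.pointPair_mem p⟩

/-- The extended chronological relation: `(P, F) ≪ (P', F')` iff `F ∩ P'` is non-empty. -/
def ExtChron (x y : C.Point) : Prop := (x.fut ∩ y.pst).Nonempty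

/-- `I⁺(p)` computed in the completion. -/
def futureOf (p : X) : Set C.Point := {y | C.ExtChron (C.incl p) y}

/-- `I⁻(p)` computed in the completion. -/
def pastOf (p : X) : Set C.Point := {y | C.ExtChron y (C.incl p)}

/-- The chronological limit operator `L`. -/
def limitOp (σ : ℕ → C.Point) : Set C.Point :=
  {x | (x.pst ≠ ∅ → LHat r (fun n ↦ (σ n).pst) x.pst) ∧
       (x.fut ≠ ∅ → LCheck r (fun n ↦ (σ n).fut) x.fut)}

theorem limitOp_subset_comp (σ : ℕ → C.Point) {u : ℕ → ℕ} (hu : StrictMono u) :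
    C.limitOp σ ⊆ C.limitOp (σ ∘ u) :=
  fun _ hx ↦ ⟨fun h ↦ (hx.1 h).comp hu, fun h ↦ (hx.2 h).comp hu⟩

/-- `A` contains `L(σ)` for every sequence `σ` in `A`. -/
def LimitClosed (A : Set C.Point) : Prop :=
  ∀ σ : ℕ → C.Point, (∀ n, σ n ∈ A) → C.limitOp σ ⊆ A

theorem LimitClosed.union {C : AdmissibleCompletion r} {A B : Set C.Point}
    (hA : C.LimitClosed A) (hB : C.LimitClosed B) : C.LimitClosed (A ∪ B) := by
  intro σ hσ x hx
  by_cases h : ∃ᶠ n in atTop, σ n ∈ A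
  · obtain ⟨u, hu, huA⟩ := extraction_of_frequently_atTop h
    exact Or.inl (hA _ huA (C.limitOp_subset_comp σ hu hx))
  · have h' : ∃ᶠ n in atTop, σ n ∈ B := by
      refine Eventually.frequently ?_
      filter_upwards [not_frequently.1 h] with n hn
      exact (hσ n).resolve_left hn
    obtain ⟨u, hu, huB⟩ := extraction_of_frequently_atTop h'
    exact Or.inr (hB _ huB (C.limitOp_subset_comp σ hu hx))

/-- The chronological topology: `A` is closed iff `L(σ) ⊆ A` for every sequence `σ` in `A`. -/
instance : TopologicalSpace C.Point :=
  TopologicalSpace.ofClosed {A | C.LimitClosed A}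
    (fun _ hσ ↦ (hσ 0).elim)
    (fun _ h𝒜 σ hσ _ hx A hA ↦ h𝒜 hA σ (fun n ↦ hσ n A hA) hx)
    (fun _ hA _ hB ↦ LimitClosed.union hA hB)

theorem isClosed_iff (A : Set C.Point) : IsClosed A ↔ C.LimitClosed A := by
  rw [← isOpen_compl_iff]
  change C.LimitClosed Aᶜᶜ ↔ _
  rw [compl_compl]

/-- The chronological topology is of first order: `σ → x` implies `x ∈ L(σ)`. -/
def FirstOrder : Prop :=
  ∀ (σ : ℕ → C.Point) (x : C.Point), Tendsto σ atTop (𝓝 x) → x ∈ C.limitOp σ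

/-- The chronological topology is separating. The closures of `y.pst` and `y.fut` are taken in
the original space, those of `I^±(x)` in the completion. -/
def Separating [TopologicalSpace X] : Prop :=
  (∀ z y : C.Point, y.fut = ∅ → y.pst ⊂ z.pst →
    ∃ x ∈ z.pst \ closure y.pst, z ∈ C.futureOf x ∧ y ∈ (closure (C.futureOf x))ᶜ) ∧
  (∀ z y : C.Point, y.pst = ∅ → y.fut ⊂ z.fut →
    ∃ x ∈ z.fut \ closure y.fut, z ∈ C.pastOf x ∧ y ∈ (closure (C.pastOf x))ᶜ)

/-- The family `Ω` attached to a sequence `x`. The finite unions may be empty. -/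
def basisFamily (x : ℕ → X) : Set (Set C.Point) :=
  {U | ∃ m k : ℕ, U = C.futureOf (x m) ∩ C.pastOf (x k)} ∪
  ({U | ∃ (m k : ℕ) (j : Fin k → ℕ),
      U = C.futureOf (x m) ∩ (closure (⋃ i, C.futureOf (x (j i))))ᶜ} ∪
   {U | ∃ (m k : ℕ) (j : Fin k → ℕ),
      U = C.pastOf (x m) ∩ (closure (⋃ i, C.pastOf (x (j i))))ᶜ})

end AdmissibleCompletion

end Limits

/-- A standard completion of a spacetime: an admissible completion as a point set, with the
extended chronological relation and the chronological topology. -/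
abbrev StandardCompletion {n : ℕ} {M : Type*} [TopologicalSpace M]
    [ChartedSpace (EuclideanSpace ℝ (Fin n)) M] [IsManifold (𝓡 n) ∞ M] (S : Spacetime n M) :=
  AdmissibleCompletion S.Chron

end CausalBoundary

open CausalBoundary

namespace CausalBoundary

/-! ### Past sets, indecomposability and limits of sequences of sets. -/

section Order

variable {X : Type*} {r : X → X → Prop}

/-! Each `C.futureOf p` and `C.pastOf p` is open, because `x ∈ L(σ)` forces the components of `x`
into the lower limits of those of `σ`. Hence convergence σ → (P, F) always yields the inclusions
into lower limits, and only maximality in the upper limits is at stake.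

If P and F are both non-empty, maximality comes for free: a larger IP in the upper limit would lie
in ↓F, against the S-relation (`mem_limitOp_of_subset_setLI`). If F = ∅, a larger IP Q in the upper
limit is the past component of some pair, and separation gives a ∈ Q with (P, ∅) outside the closure
of I⁺(a). But σ meets I⁺(a) infinitely often, which contradicts convergence. The case P = ∅ is dual.

For the basis, suppose that no member of Ω fits between y and an open U. Choose a sequence outside U
in ever smaller members of Ω around y. Chains from the dense sequence exhausting P and F
(`IsIP.exists_chain`) force the inclusions into lower limits. If a component of y is empty, removing
more and more futures (or pasts) whose closures miss y forces maximality. So y ∈ L(σ), which is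
impossible as the complement of U is closed.

Second countability needs one chronologically dense sequence. Any dense sequence of M is one, as p ≪
q leaves a non-empty open set of points between p and q; this is proved by perturbing a timelike arc
in a chart. -/

theorem IsPastSet.mem_of_rel {P : Set X} (h : IsPastSet r P) {p q : X} (hq : q ∈ P)
    (hpq : r p q) : p ∈ P := by
  rw [← h]
  exact ⟨q, hq, hpq⟩

theorem IsPastSet.exists_rel {P : Set X} (h : IsPastSet r P) {p : X} (hp : p ∈ P) :
    ∃ q ∈ P, r p q := by
  rw [← h] at hp
  exact hp

theorem isPastSet_empty : IsPastSet r (∅ : Set X) := by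
  simp [IsPastSet, setPast]

theorem ChronDense.flip {D : Set X} (h : ChronDense r D) : ChronDense (flip r) D := by
  intro p q hpq
  obtain ⟨s, hs, h1, h2⟩ := h q p hpq
  exact ⟨s, hs, h2, h1⟩

theorem isPastSet_setPast (htr : ∀ ⦃a b c⦄, r a b → r b c → r a c) {D : Set X}
    (hD : ChronDense r D) (A : Set X) : IsPastSet r (setPast r A) := by
  ext p
  constructor
  · rintro ⟨q, ⟨a, ha, hqa⟩, hpq⟩
    exact ⟨a, ha, htr hpq hqa⟩
  · rintro ⟨a, ha, hpa⟩
    obtain ⟨s, -, hps, hsa⟩ := hD p a hpa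
    exact ⟨s, ⟨a, ha, hsa⟩, hps⟩

/-- Indecomposable past sets are directed. -/
theorem IsIP.directed (htr : ∀ ⦃a b c⦄, r a b → r b c → r a c) {D : Set X}
    (hD : ChronDense r D) {P : Set X} (hP : IsIP r P) {a b : X} (ha : a ∈ P) (hb : b ∈ P) :
    ∃ c ∈ P, r a c ∧ r b c := by
  obtain ⟨-, hpast, hind⟩ := hP
  by_contra! hno
  -- Split P according to whether a point lies after `a`. The past of the first piece misses `b`,
  -- since `a` and `b` have no common bound; the past of the second misses `a`.
  refine hind ⟨setPast r (P ∩ {c | r a c}), setPast r (P \ {c | r a c}), ?_, ?_,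
    isPastSet_setPast htr hD _, isPastSet_setPast htr hD _, ?_⟩
  · refine (ssubset_iff_of_subset ?_).2 ⟨b, hb, ?_⟩
    · rintro p ⟨q, hq, hpq⟩
      exact hpast.mem_of_rel hq.1 hpq
    · rintro ⟨c, hc, hbc⟩
      exact hno c hc.1 hc.2 hbc
  · refine (ssubset_iff_of_subset ?_).2 ⟨a, ha, ?_⟩
    · rintro p ⟨q, hq, hpq⟩
      exact hpast.mem_of_rel hq.1 hpq
    · rintro ⟨c, hc, hac⟩
      exact hc.2 hac
  · ext p
    constructor
    · intro hp
      obtain ⟨q, hq, hpq⟩ := hpast.exists_rel hp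
      by_cases h : r a q
      · exact Or.inl ⟨q, ⟨hq, h⟩, hpq⟩
      · exact Or.inr ⟨q, ⟨hq, h⟩, hpq⟩
    · rintro (⟨q, hq, hpq⟩ | ⟨q, hq, hpq⟩)
      · exact hpast.mem_of_rel hq.1 hpq
      · exact hpast.mem_of_rel hq.1 hpq

/-- An indecomposable past set is generated by a chain of points of a given chronologically
dense sequence. -/
theorem IsIP.exists_chain (htr : ∀ ⦃a b c⦄, r a b → r b c → r a c) {x : ℕ → X}
    (hx : ChronDense r (range x)) {P : Set X} (hP : IsIP r P) :
    ∃ p : ℕ → ℕ, (∀ k, x (p k) ∈ P) ∧ ∀ q ∈ P, ∀ᶠ k in atTop, r q (x (p k)) := by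
  classical
  have hpast : IsPastSet r P := hP.2.1
  have hnext : ∀ q ∈ P, ∃ i, x i ∈ P ∧ r q (x i) := by
    intro q hq
    obtain ⟨q', hq', h⟩ := hpast.exists_rel hq
    obtain ⟨_, ⟨i, rfl⟩, h1, h2⟩ := hx _ _ h
    exact ⟨i, hpast.mem_of_rel hq' h2, h1⟩
  have hdir : ∀ i j : {i // x i ∈ P}, ∃ k : {i // x i ∈ P}, r (x i) (x k) ∧ r (x j) (x k) := by
    rintro ⟨i, hi⟩ ⟨j, hj⟩
    obtain ⟨c, hc, hic, hjc⟩ := hP.directed htr hx hi hj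
    obtain ⟨k, hk, hck⟩ := hnext c hc
    exact ⟨⟨k, hk⟩, htr hic hck, htr hjc hck⟩
  choose f hf using hdir
  obtain ⟨q₀, hq₀⟩ := hP.1
  obtain ⟨i₀, hi₀, -⟩ := hnext q₀ hq₀
  -- `e` lists the indices of points in P, with default `i₀`. Stage `k + 1` of `p` dominates both
  -- stage `k` and entry `k`, so `x j` is dominated from stage `j + 1` on.
  let e : ℕ → {i // x i ∈ P} := fun k ↦ if h : x k ∈ P then ⟨k, h⟩ else ⟨i₀, hi₀⟩
  let p : ℕ → {i // x i ∈ P} := fun k ↦ Nat.rec ⟨i₀, hi₀⟩ (fun k c ↦ f (e k) c) k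
  refine ⟨fun k ↦ (p k).1, fun k ↦ (p k).2, fun q hq ↦ ?_⟩
  obtain ⟨j, hj, hqj⟩ := hnext q hq
  refine eventually_atTop.2 ⟨j + 1, fun k hk ↦ ?_⟩
  induction k, hk using Nat.le_induction with
  | base =>
    have he : e j = ⟨j, hj⟩ := dif_pos hj
    have h := (hf (e j) (p j)).1
    rw [he] at h
    change r q (x (f (e j) (p j)))
    rw [he]
    exact htr hqj h
  | succ k _ ih => exact htr ih (hf (e k) (p k)).2

theorem subset_setLI_of_chain {P : Set X} {A : ℕ → Set X} {p : ℕ → X}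
    (hp : ∀ q ∈ P, ∀ᶠ k in atTop, r q (p k)) (hA : ∀ k, IsPastSet r (A k))
    (hpA : ∀ k, p k ∈ A k) : P ⊆ setLI A := fun q hq ↦ by
  filter_upwards [hp q hq] with k hk
  exact (hA k).mem_of_rel (hpA k) hk

theorem subset_setLS_of_subset_setLI {P : Set X} {A : ℕ → Set X} (h : P ⊆ setLI A) :
    P ⊆ setLS A :=
  fun _ hx ↦ Eventually.frequently (h hx)

/-- Isolates maximality, the one part of a limit that does not follow from openness of futures and
pasts. -/
theorem LHat.of_not_ssubset {P : Set X} {A : ℕ → Set X} (hP : IsIP r P) (hPA : P ⊆ setLI A)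
    (h : ∀ Q, IsIP r Q → P ⊂ Q → ¬ Q ⊆ setLS A) : LHat r A P := by
  refine ⟨hPA, ⟨hP, subset_setLS_of_subset_setLI hPA⟩, fun Q hQ hPQ ↦ ?_⟩
  by_contra hQP
  exact h Q hQ.1 ⟨hPQ, hQP⟩ hQ.2

/-- If the sets `A n` lie in the past of the sets `B n`, and the lower limit of the latter
contains `F`, then a maximal IP of `↓F` is a limit as soon as it lies in the lower limit. -/
theorem LHat.of_isMaximalIPIn_commonPast {P F : Set X} {A B : ℕ → Set X}
    (hAB : ∀ n, ∀ a ∈ A n, ∀ b ∈ B n, r a b) (hP : IsMaximalIPIn r (commonPast r F) P)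
    (hPA : P ⊆ setLI A) (hFB : F ⊆ setLI B) : LHat r A P := by
  refine LHat.of_not_ssubset hP.prop.1 hPA fun Q hQ hPQ hQA ↦ hPQ.2 ?_
  refine hP.le_of_ge ⟨hQ, fun q hq ↦ ?_⟩ hPQ.1
  -- `q'` precedes all of F: given `b ∈ F`, some index `n` has both `q' ∈ A n` and `b ∈ B n`.
  obtain ⟨q', hq', h⟩ := hQ.2.1.exists_rel hq
  refine ⟨q', fun b hb ↦ ?_, h⟩
  obtain ⟨n, hn, hn'⟩ := ((hQA hq' : ∃ᶠ n in atTop, _).and_eventually (hFB hb)).exists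
  exact hAB n _ hn _ hn'

end Order

/-! ### Pairs of a completion, openness of futures and pasts, first order. -/

namespace AdmissibleCompletion

section

variable {X : Type*} {r : X → X → Prop} {C : AdmissibleCompletion r}

theorem Point.isIP_pst (y : C.Point) (h : y.pst ≠ ∅) : IsIP r y.pst := by
  rcases C.sRelated y.1 y.2 with ⟨h1, -⟩ | ⟨h1, -⟩ | ⟨h1, -⟩
  · exact h1
  · exact h1
  · exact (h h1).elim

theorem Point.isIP_fut (y : C.Point) (h : y.fut ≠ ∅) : IsIP (flip r) y.fut := by
  rcases C.sRelated y.1 y.2 with ⟨-, h1, -⟩ | ⟨-, h1, -⟩ | ⟨-, h1, -⟩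
  · exact h1
  · exact (h h1).elim
  · exact h1

theorem Point.pst_ne_empty_or (y : C.Point) : y.pst ≠ ∅ ∨ y.fut ≠ ∅ := by
  rcases C.sRelated y.1 y.2 with ⟨h1, -⟩ | ⟨h1, -⟩ | ⟨-, h1, -⟩
  · exact Or.inl h1.1.ne_empty
  · exact Or.inl h1.1.ne_empty
  · exact Or.inr h1.1.ne_empty

theorem Point.isPastSet_pst (y : C.Point) : IsPastSet r y.pst := by
  by_cases h : y.pst = ∅
  · exact h ▸ isPastSet_empty
  · exact (y.isIP_pst h).2.1

theorem Point.isPastSet_fut (y : C.Point) : IsPastSet (flip r) y.fut := by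
  by_cases h : y.fut = ∅
  · exact h ▸ isPastSet_empty
  · exact (y.isIP_fut h).2.1

theorem Point.sRelatedNonempty (y : C.Point) (h₁ : y.pst ≠ ∅) (h₂ : y.fut ≠ ∅) :
    SRelatedNonempty r y.pst y.fut := by
  rcases C.sRelated y.1 y.2 with ⟨-, -, h⟩ | ⟨-, h, -⟩ | ⟨h, -⟩
  · exact h
  · exact (h₂ h).elim
  · exact (h₁ h).elim

/-- By F ⊆ ↑P, `b` lies after a common upper bound of P. -/
theorem Point.rel_of_mem (htr : ∀ ⦃a b c⦄, r a b → r b c → r a c) (y : C.Point) {a b : X}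
    (ha : a ∈ y.pst) (hb : b ∈ y.fut) : r a b := by
  obtain ⟨q, hq, hqb⟩ := (y.sRelatedNonempty (nonempty_of_mem ha).ne_empty
    (nonempty_of_mem hb).ne_empty).1.prop.2 hb
  exact htr (hq a ha) hqb

theorem mem_futureOf {p : X} {y : C.Point} : y ∈ C.futureOf p ↔ p ∈ y.pst :=
  ⟨fun ⟨_, hq, hq'⟩ ↦ y.isPastSet_pst.mem_of_rel hq' hq, fun hp ↦
    let ⟨q, hq, hpq⟩ := y.isPastSet_pst.exists_rel hp
    ⟨q, hpq, hq⟩⟩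

theorem mem_pastOf {p : X} {y : C.Point} : y ∈ C.pastOf p ↔ p ∈ y.fut :=
  ⟨fun ⟨_, hq, hq'⟩ ↦ y.isPastSet_fut.mem_of_rel hq hq', fun hp ↦
    let ⟨q, hq, hpq⟩ := y.isPastSet_fut.exists_rel hp
    ⟨q, hq, hpq⟩⟩

theorem isOpen_futureOf (p : X) : IsOpen (C.futureOf p) := by
  rw [← isClosed_compl_iff, isClosed_iff]
  intro σ hσ y hy hyp
  rw [mem_futureOf] at hyp
  obtain ⟨k, hk⟩ := ((hy.1 (nonempty_of_mem hyp).ne_empty).1 hyp : ∀ᶠ n in atTop, _).exists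
  exact hσ k (mem_futureOf.2 hk)

theorem isOpen_pastOf (p : X) : IsOpen (C.pastOf p) := by
  rw [← isClosed_compl_iff, isClosed_iff]
  intro σ hσ y hy hyp
  rw [mem_pastOf] at hyp
  obtain ⟨k, hk⟩ := ((hy.2 (nonempty_of_mem hyp).ne_empty).1 hyp : ∀ᶠ n in atTop, _).exists
  exact hσ k (mem_pastOf.2 hk)

/-- Lets separation, which speaks of pairs, be applied to an arbitrary IP. -/
theorem exists_pst_eq {P : Set X} (hP : IsIP r P) : ∃ z : C.Point, z.pst = P := by
  by_cases h : ∃ x, P = pointPast r x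
  · obtain ⟨x, rfl⟩ := h
    exact ⟨C.incl x, rfl⟩
  · obtain ⟨z, hz, rfl⟩ := C.exists_of_isTIP P ⟨hP, not_exists.1 h⟩
    exact ⟨⟨z, hz.1⟩, rfl⟩

theorem exists_fut_eq {F : Set X} (hF : IsIP (flip r) F) : ∃ z : C.Point, z.fut = F := by
  by_cases h : ∃ x, F = pointFuture r x
  · obtain ⟨x, rfl⟩ := h
    exact ⟨C.incl x, rfl⟩
  · obtain ⟨z, hz, rfl⟩ := C.exists_of_isTIF F ⟨hF, not_exists.1 h⟩
    exact ⟨⟨z, hz.1⟩, rfl⟩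

/-- The S-relation supplies maximality of each component, so lower limits alone decide convergence
at such pairs. -/
theorem mem_limitOp_of_subset_setLI (htr : ∀ ⦃a b c⦄, r a b → r b c → r a c) {y : C.Point}
    {σ : ℕ → C.Point} (h₁ : y.pst ≠ ∅) (h₂ : y.fut ≠ ∅)
    (hP : y.pst ⊆ setLI fun n ↦ (σ n).pst) (hF : y.fut ⊆ setLI fun n ↦ (σ n).fut) :
    y ∈ C.limitOp σ := by
  have hy := y.sRelatedNonempty h₁ h₂
  exact ⟨fun _ ↦ LHat.of_isMaximalIPIn_commonPast
      (fun n a ha b hb ↦ (σ n).rel_of_mem htr ha hb) hy.2 hP hF,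
    fun _ ↦ LHat.of_isMaximalIPIn_commonPast (r := flip r)
      (fun n b hb a ha ↦ (σ n).rel_of_mem htr ha hb) hy.1 hF hP⟩

theorem subset_setLI_pst_of_tendsto {σ : ℕ → C.Point} {y : C.Point}
    (h : Tendsto σ atTop (𝓝 y)) : y.pst ⊆ setLI fun n ↦ (σ n).pst := fun p hp ↦ by
  filter_upwards [h ((isOpen_futureOf p).mem_nhds (mem_futureOf.2 hp))] with n hn
  exact mem_futureOf.1 hn

theorem subset_setLI_fut_of_tendsto {σ : ℕ → C.Point} {y : C.Point}
    (h : Tendsto σ atTop (𝓝 y)) : y.fut ⊆ setLI fun n ↦ (σ n).fut := fun p hp ↦ by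
  filter_upwards [h ((isOpen_pastOf p).mem_nhds (mem_pastOf.2 hp))] with n hn
  exact mem_pastOf.1 hn

theorem Separating.firstOrder [TopologicalSpace X] (hC : C.Separating)
    (htr : ∀ ⦃a b c⦄, r a b → r b c → r a c) : C.FirstOrder := by
  intro σ y hσ
  have hP := subset_setLI_pst_of_tendsto hσ
  have hF := subset_setLI_fut_of_tendsto hσ
  by_cases h₁ : y.pst = ∅
  · refine ⟨fun h ↦ (h h₁).elim, fun h₂ ↦ LHat.of_not_ssubset (r := flip r)
      (y.isIP_fut h₂) hF fun Q hQ hyQ hQσ ↦ ?_⟩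
    obtain ⟨z, rfl⟩ := exists_fut_eq (C := C) hQ
    obtain ⟨x, hx, -, hyx⟩ := hC.2 z y h₁ hyQ
    obtain ⟨n, hn, hn'⟩ := ((hQσ hx.1 : ∃ᶠ n in atTop, _).and_eventually
      (hσ (isClosed_closure.isOpen_compl.mem_nhds hyx))).exists
    exact hn' (subset_closure (mem_pastOf.2 hn))
  by_cases h₂ : y.fut = ∅
  · refine ⟨fun _ ↦ LHat.of_not_ssubset (y.isIP_pst h₁) hP fun Q hQ hyQ hQσ ↦ ?_,
      fun h ↦ (h h₂).elim⟩
    obtain ⟨z, rfl⟩ := exists_pst_eq (C := C) hQ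
    obtain ⟨x, hx, -, hyx⟩ := hC.1 z y h₂ hyQ
    obtain ⟨n, hn, hn'⟩ := ((hQσ hx.1 : ∃ᶠ n in atTop, _).and_eventually
      (hσ (isClosed_closure.isOpen_compl.mem_nhds hyx))).exists
    exact hn' (subset_closure (mem_futureOf.2 hn))
  exact mem_limitOp_of_subset_setLI htr h₁ h₂ hP hF

/-! ### The family Ω as a countable basis, and density. -/

theorem isOpen_of_mem_basisFamily {x : ℕ → X} {U : Set C.Point} (hU : U ∈ C.basisFamily x) :
    IsOpen U := by
  rcases hU with ⟨m, k, rfl⟩ | ⟨m, k, j, rfl⟩ | ⟨m, k, j, rfl⟩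
  · exact (isOpen_futureOf _).inter (isOpen_pastOf _)
  · exact (isOpen_futureOf _).inter isClosed_closure.isOpen_compl
  · exact (isOpen_pastOf _).inter isClosed_closure.isOpen_compl

theorem countable_basisFamily (x : ℕ → X) : (C.basisFamily x).Countable := by
  refine Countable.union ?_ (Countable.union ?_ ?_)
  · refine (countable_range fun i : ℕ × ℕ ↦ C.futureOf (x i.1) ∩ C.pastOf (x i.2)).mono ?_
    rintro _ ⟨m, k, rfl⟩
    exact ⟨(m, k), rfl⟩
  · refine (countable_range fun i : ℕ × (Σ k, Fin k → ℕ) ↦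
      C.futureOf (x i.1) ∩ (closure (⋃ l, C.futureOf (x (i.2.2 l))))ᶜ).mono ?_
    rintro _ ⟨m, k, j, rfl⟩
    exact ⟨(m, ⟨k, j⟩), rfl⟩
  · refine (countable_range fun i : ℕ × (Σ k, Fin k → ℕ) ↦
      C.pastOf (x i.1) ∩ (closure (⋃ l, C.pastOf (x (i.2.2 l))))ᶜ).mono ?_
    rintro _ ⟨m, k, j, rfl⟩
    exact ⟨(m, ⟨k, j⟩), rfl⟩

/-- Sequences outside of an open set do not converge to its points. -/
theorem notMem_limitOp {U : Set C.Point} (hU : IsOpen U) {y : C.Point} (hy : y ∈ U)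
    {σ : ℕ → C.Point} (hσ : ∀ n, σ n ∉ U) : y ∉ C.limitOp σ := fun h ↦
  (C.isClosed_iff _).1 hU.isClosed_compl σ hσ h hy

theorem exists_fin_subset_iUnion {α : Type*} (J : Set ℕ) (f : ℕ → Set α) (k : ℕ) :
    ∃ (l : ℕ) (j : Fin l → ℕ), (∀ i, j i ∈ J) ∧ ∀ n ∈ J, n < k → f n ⊆ ⋃ i, f (j i) := by
  classical
  let s : Finset ℕ := (Finset.range k).filter (· ∈ J)
  refine ⟨s.card, fun i ↦ s.equivFin.symm i, fun i ↦ ?_, fun n hn hnk ↦ ?_⟩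
  · exact (Finset.mem_filter.1 (s.equivFin.symm i).2).2
  · have hs : n ∈ s := Finset.mem_filter.2 ⟨Finset.mem_range.2 hnk, hn⟩
    refine subset_iUnion_of_subset (s.equivFin ⟨n, hs⟩) ?_
    simp

/-- The finite unions in Ω serve to keep larger IPs out of the upper limit: the `k`-th set removes
I⁺(xᵢ) for all i < k for which this can be done without losing `y`. -/
theorem Separating.exists_basis_of_fut_eq_empty [TopologicalSpace X] (hC : C.Separating)
    (htr : ∀ ⦃a b c⦄, r a b → r b c → r a c) {x : ℕ → X} (hx : ChronDense r (range x))
    {U : Set C.Point} (hU : IsOpen U) {y : C.Point} (hyU : y ∈ U) (hy : y.fut = ∅) :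
    ∃ V ∈ C.basisFamily x, y ∈ V ∧ V ⊆ U := by
  have hne : y.pst ≠ ∅ := y.pst_ne_empty_or.resolve_right (not_not.2 hy)
  obtain ⟨p, hpP, hp⟩ := (y.isIP_pst hne).exists_chain htr hx
  by_contra! hno
  let J : Set ℕ := {i | y ∉ closure (C.futureOf (x i))}
  choose l j hjJ hj using exists_fin_subset_iUnion J fun i ↦ C.futureOf (x i)
  have hV : ∀ k, ∃ z, z ∈ C.futureOf (x (p k)) ∩ (closure (⋃ i, C.futureOf (x (j k i))))ᶜ ∧
      z ∉ U := by
    intro k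
    refine not_subset.1 (hno _ (Or.inr (Or.inl ⟨p k, l k, j k, rfl⟩))
      ⟨mem_futureOf.2 (hpP k), ?_⟩)
    -- Finiteness is essential: the closure of the union is the union of the closures, each of which
    -- misses `y`.
    rw [mem_compl_iff, closure_iUnion_of_finite, mem_iUnion]
    rintro ⟨i, hi⟩
    exact hjJ k i hi
  choose σ hσ hσU using hV
  have hLI : y.pst ⊆ setLI fun n ↦ (σ n).pst := subset_setLI_of_chain hp
    (fun k ↦ (σ k).isPastSet_pst) fun k ↦ mem_futureOf.1 (hσ k).1
  refine notMem_limitOp hU hyU hσU ⟨fun _ ↦ LHat.of_not_ssubset (y.isIP_pst hne) hLI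
    fun Q hQ hyQ hQσ ↦ ?_, fun h ↦ (h hy).elim⟩
  obtain ⟨z, rfl⟩ := exists_pst_eq (C := C) hQ
  obtain ⟨a, ha, -, hya⟩ := hC.1 z y hy hyQ
  -- Replace the separating point `a` by a later `x i` still in the larger IP. Its future is
  -- smaller, so `i ∈ J`, and `σ n` avoids I⁺(xᵢ) for n > i although `x i` lies in the upper limit.
  obtain ⟨b, hb, hab⟩ := z.isPastSet_pst.exists_rel ha.1
  obtain ⟨_, ⟨i, rfl⟩, hai, hib⟩ := hx a b hab
  have hiJ : i ∈ J := fun h ↦ hya (closure_mono (fun w hw ↦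
    mem_futureOf.2 (w.isPastSet_pst.mem_of_rel (mem_futureOf.1 hw) hai)) h)
  obtain ⟨n, hn, hin⟩ := ((hQσ (z.isPastSet_pst.mem_of_rel hb hib) :
    ∃ᶠ n in atTop, _).and_eventually (eventually_gt_atTop i)).exists
  exact (hσ n).2 (subset_closure (hj n i hiJ hin (mem_futureOf.2 hn)))

theorem Separating.exists_basis_of_pst_eq_empty [TopologicalSpace X] (hC : C.Separating)
    (htr : ∀ ⦃a b c⦄, r a b → r b c → r a c) {x : ℕ → X} (hx : ChronDense r (range x))
    {U : Set C.Point} (hU : IsOpen U) {y : C.Point} (hyU : y ∈ U) (hy : y.pst = ∅) :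
    ∃ V ∈ C.basisFamily x, y ∈ V ∧ V ⊆ U := by
  have hne : y.fut ≠ ∅ := y.pst_ne_empty_or.resolve_left (not_not.2 hy)
  obtain ⟨p, hpF, hp⟩ := (y.isIP_fut hne).exists_chain (r := flip r) (fun _ _ _ h h' ↦ htr h' h) hx.flip
  by_contra! hno
  let J : Set ℕ := {i | y ∉ closure (C.pastOf (x i))}
  choose l j hjJ hj using exists_fin_subset_iUnion J fun i ↦ C.pastOf (x i)
  have hV : ∀ k, ∃ z, z ∈ C.pastOf (x (p k)) ∩ (closure (⋃ i, C.pastOf (x (j k i))))ᶜ ∧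
      z ∉ U := by
    intro k
    refine not_subset.1 (hno _ (Or.inr (Or.inr ⟨p k, l k, j k, rfl⟩))
      ⟨mem_pastOf.2 (hpF k), ?_⟩)
    rw [mem_compl_iff, closure_iUnion_of_finite, mem_iUnion]
    rintro ⟨i, hi⟩
    exact hjJ k i hi
  choose σ hσ hσU using hV
  have hLI : y.fut ⊆ setLI fun n ↦ (σ n).fut := subset_setLI_of_chain hp
    (fun k ↦ (σ k).isPastSet_fut) fun k ↦ mem_pastOf.1 (hσ k).1
  refine notMem_limitOp hU hyU hσU ⟨fun h ↦ (h hy).elim, fun _ ↦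
    LHat.of_not_ssubset (r := flip r) (y.isIP_fut hne) hLI fun Q hQ hyQ hQσ ↦ ?_⟩
  obtain ⟨z, rfl⟩ := exists_fut_eq (C := C) hQ
  obtain ⟨a, ha, -, hya⟩ := hC.2 z y hy hyQ
  obtain ⟨b, hb, hab⟩ := z.isPastSet_fut.exists_rel ha.1
  obtain ⟨_, ⟨i, rfl⟩, hai, hib⟩ := hx.flip a b hab
  have hiJ : i ∈ J := fun h ↦ hya (closure_mono (fun w hw ↦
    mem_pastOf.2 (w.isPastSet_fut.mem_of_rel (mem_pastOf.1 hw) hai)) h)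
  obtain ⟨n, hn, hin⟩ := ((hQσ (z.isPastSet_fut.mem_of_rel hb hib) :
    ∃ᶠ n in atTop, _).and_eventually (eventually_gt_atTop i)).exists
  exact (hσ n).2 (subset_closure (hj n i hiJ hin (mem_pastOf.2 hn)))

theorem exists_basis_of_ne_empty (htr : ∀ ⦃a b c⦄, r a b → r b c → r a c) {x : ℕ → X}
    (hx : ChronDense r (range x)) {U : Set C.Point} (hU : IsOpen U) {y : C.Point} (hyU : y ∈ U)
    (h₁ : y.pst ≠ ∅) (h₂ : y.fut ≠ ∅) : ∃ V ∈ C.basisFamily x, y ∈ V ∧ V ⊆ U := by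
  obtain ⟨p, hpP, hp⟩ := (y.isIP_pst h₁).exists_chain htr hx
  obtain ⟨f, hfF, hf⟩ := (y.isIP_fut h₂).exists_chain (r := flip r) (fun _ _ _ h h' ↦ htr h' h) hx.flip
  by_contra! hno
  have hV : ∀ k, ∃ z, z ∈ C.futureOf (x (p k)) ∩ C.pastOf (x (f k)) ∧ z ∉ U := fun k ↦
    not_subset.1 (hno _ (Or.inl ⟨p k, f k, rfl⟩)
      ⟨mem_futureOf.2 (hpP k), mem_pastOf.2 (hfF k)⟩)
  choose σ hσ hσU using hV
  exact notMem_limitOp hU hyU hσU (mem_limitOp_of_subset_setLI htr h₁ h₂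
    (subset_setLI_of_chain hp (fun k ↦ (σ k).isPastSet_pst) fun k ↦ mem_futureOf.1 (hσ k).1)
    (subset_setLI_of_chain hf (fun k ↦ (σ k).isPastSet_fut) fun k ↦ mem_pastOf.1 (hσ k).2))

theorem Separating.isTopologicalBasis_basisFamily [TopologicalSpace X] (hC : C.Separating)
    (htr : ∀ ⦃a b c⦄, r a b → r b c → r a c) {x : ℕ → X} (hx : ChronDense r (range x)) :
    TopologicalSpace.IsTopologicalBasis (C.basisFamily x) := by
  refine TopologicalSpace.isTopologicalBasis_of_isOpen_of_nhds
    (fun U hU ↦ isOpen_of_mem_basisFamily hU) fun y U hyU hU ↦ ?_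
  by_cases h₁ : y.pst = ∅
  · exact hC.exists_basis_of_pst_eq_empty htr hx hU hyU h₁
  by_cases h₂ : y.fut = ∅
  · exact hC.exists_basis_of_fut_eq_empty htr hx hU hyU h₂
  exact exists_basis_of_ne_empty htr hx hU hyU h₁ h₂

/-- The images of the points of a chronologically dense sequence are dense in a completion. -/
theorem dense_range_incl (htr : ∀ ⦃a b c⦄, r a b → r b c → r a c) {x : ℕ → X}
    (hx : ChronDense r (range x)) : Dense (range fun i ↦ C.incl (x i)) := by
  intro y
  by_contra hy
  have hlim : ∀ p : ℕ → ℕ, y ∉ C.limitOp fun k ↦ C.incl (x (p k)) := fun p ↦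
    notMem_limitOp isClosed_closure.isOpen_compl hy
      fun k ↦ not_not.2 (subset_closure ⟨p k, rfl⟩)
  by_cases h₁ : y.pst = ∅
  · have h₂ : y.fut ≠ ∅ := y.pst_ne_empty_or.resolve_left (not_not.2 h₁)
    obtain ⟨f, hfF, hf⟩ := (y.isIP_fut h₂).exists_chain (r := flip r) (fun _ _ _ h h' ↦ htr h' h) hx.flip
    -- Separation is not needed here: the chain lies in `y.fut`, so the upper limit of its futures
    -- is contained in `y.fut`.
    refine hlim f ⟨fun h ↦ (h h₁).elim, fun _ ↦ LHat.of_not_ssubset (r := flip r)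
      (y.isIP_fut h₂) hf fun Q _ hyQ hQσ ↦ hyQ.2 fun q hq ↦ ?_⟩
    obtain ⟨n, hn⟩ := (hQσ hq : ∃ᶠ n in atTop, _).exists
    exact y.isPastSet_fut.mem_of_rel (hfF n) hn
  obtain ⟨p, hpP, hp⟩ := (y.isIP_pst h₁).exists_chain htr hx
  by_cases h₂ : y.fut = ∅
  · refine hlim p ⟨fun _ ↦ LHat.of_not_ssubset (y.isIP_pst h₁) hp
      fun Q _ hyQ hQσ ↦ hyQ.2 fun q hq ↦ ?_, fun h ↦ (h h₂).elim⟩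
    obtain ⟨n, hn⟩ := (hQσ hq : ∃ᶠ n in atTop, _).exists
    exact y.isPastSet_pst.mem_of_rel (hpP n) hn
  obtain ⟨f, hfF, hf⟩ := (y.isIP_fut h₂).exists_chain (r := flip r) (fun _ _ _ h h' ↦ htr h' h) hx.flip
  -- Points squeezed between the chains of the two components have both components of `y` in their
  -- lower limits.
  have hs : ∀ k, ∃ i, r (x (p k)) (x i) ∧ r (x i) (x (f k)) := fun k ↦ by
    obtain ⟨_, ⟨i, rfl⟩, h⟩ := hx _ _ (y.rel_of_mem htr (hpP k) (hfF k))
    exact ⟨i, h⟩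
  choose s hs₁ hs₂ using hs
  refine hlim s (mem_limitOp_of_subset_setLI htr h₁ h₂ (fun q hq ↦ ?_) fun q hq ↦ ?_)
  · filter_upwards [hp q hq] with k hk
    exact htr hk (hs₁ k)
  · filter_upwards [hf q hq] with k hk
    exact htr (hs₂ k) hk

end

end AdmissibleCompletion

/-! ### Timelike curves and openness between chronologically related points. -/

section Arcs

variable {n : ℕ} {M : Type*} [TopologicalSpace M] [ChartedSpace (EuclideanSpace ℝ (Fin n)) M]
  {K : ∀ p : M, TangentSpace (𝓡 n) p → Prop}

theorem IsSmoothArc.mono {γ : ℝ → M} {a b a' b' : ℝ} (h : IsSmoothArc K γ a b) (ha : a ≤ a')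
    (hab : a' < b') (hb : b' ≤ b) : IsSmoothArc K γ a' b' := by
  have hsub : Icc a' b' ⊆ Icc a b := Icc_subset_Icc ha hb
  refine ⟨hab, h.2.1.mono hsub, fun t ht ↦ ?_⟩
  rw [((h.2.1.mdifferentiableOn (by simp) t (hsub ht)).hasMFDerivWithinAt.mono
    hsub).mfderivWithin ((uniqueDiffOn_Icc hab).uniqueMDiffOn t ht)]
  exact h.2.2 t (hsub ht)

end Arcs

section Geometry

variable {n : ℕ} {M : Type*} [TopologicalSpace M] [ChartedSpace (EuclideanSpace ℝ (Fin n)) M]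
  [IsManifold (𝓡 n) ∞ M]

theorem LorentzianMetric.continuous_inner (g : LorentzianMetric n M) {Y : Type*}
    [TopologicalSpace Y] {b : Y → M} {v w : ∀ y, TangentSpace (𝓡 n) (b y)}
    (hv : Continuous fun y ↦ (⟨b y, v y⟩ : TangentBundle (𝓡 n) M))
    (hw : Continuous fun y ↦ (⟨b y, w y⟩ : TangentBundle (𝓡 n) M)) :
    Continuous fun y ↦ g.inner (b y) (v y) (w y) := by
  have hb : Continuous b := (FiberBundle.continuous_proj _ _).comp hv
  have h : Continuous (fun y ↦ TotalSpace.mk' ℝ (E := Bundle.Trivial M ℝ) (b y)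
      (g.inner (b y) (v y) (w y))) :=
    Continuous.clm_bundle_apply₂ (F₁ := EuclideanSpace ℝ (Fin n))
      (F₂ := EuclideanSpace ℝ (Fin n)) (g.contMDiff.continuous.comp hb) hv hw
  rw [continuous_iff_continuousAt] at h ⊢
  intro y
  have := h y
  simp only [FiberBundle.continuousAt_totalSpace] at this
  exact this.2

/-- Both defining inequalities are strict, with sides continuous on the tangent bundle. -/
theorem Spacetime.isOpen_isFutureTimelike (S : Spacetime n M) :
    IsOpen {v : TangentBundle (𝓡 n) M | S.IsFutureTimelike v.1 v.2} := by
  have hid : Continuous fun v : TangentBundle (𝓡 n) M ↦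
    (⟨v.1, v.2⟩ : TangentBundle (𝓡 n) M) := continuous_id
  have hT : Continuous fun v : TangentBundle (𝓡 n) M ↦
      (⟨v.1, S.timeField v.1⟩ : TangentBundle (𝓡 n) M) :=
    S.contMDiff_timeField.continuous.comp (FiberBundle.continuous_proj _ _)
  exact (isOpen_lt (S.continuous_inner hid hid) continuous_const).inter
    (isOpen_lt (S.continuous_inner hT hid) continuous_const)

/-- The expression in a chart of a cone field. -/
def chartCone (K : ∀ p : M, TangentSpace (𝓡 n) p → Prop) (p : M) :
    Set (EuclideanSpace ℝ (Fin n) × EuclideanSpace ℝ (Fin n)) :=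
  {z | z.1 ∈ (chartAt (EuclideanSpace ℝ (Fin n)) p).target ∧
    K ((chartAt (EuclideanSpace ℝ (Fin n)) p).symm z.1)
      (mfderiv (𝓡 n) (𝓡 n) (chartAt (EuclideanSpace ℝ (Fin n)) p).symm z.1 z.2)}

variable {K : ∀ p : M, TangentSpace (𝓡 n) p → Prop}

theorem isOpen_chartCone (hK : IsOpen {v : TangentBundle (𝓡 n) M | K v.1 v.2}) (p : M) :
    IsOpen (chartCone K p) := by
  set e := chartAt (EuclideanSpace ℝ (Fin n)) p
  have hs : ContMDiffOn (𝓡 n) (𝓡 n) ∞ e.symm e.target := contMDiffOn_chart_symm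
  have hcont := hs.continuousOn_tangentMapWithin (by simp) e.open_target.uniqueMDiffOn
  have hopen := hcont.isOpen_inter_preimage
    (e.open_target.preimage (FiberBundle.continuous_proj _ _)) hK
  have hEq : chartCone K p =
      (tangentBundleModelSpaceHomeomorph (𝓡 n) (H := EuclideanSpace ℝ (Fin n))).symm ⁻¹'
        (TotalSpace.proj ⁻¹' e.target ∩ tangentMapWithin (𝓡 n) (𝓡 n) e.symm e.target ⁻¹'
          {v : TangentBundle (𝓡 n) M | K v.1 v.2}) := by
    ext ⟨y, w⟩
    refine and_congr_right fun hy ↦ ?_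
    change _ ↔ K (e.symm y) (mfderivWithin (𝓡 n) (𝓡 n) e.symm e.target y w)
    rw [mfderivWithin_of_isOpen e.open_target hy]
  rw [hEq]
  exact hopen.preimage
    (tangentBundleModelSpaceHomeomorph (𝓡 n) (H := EuclideanSpace ℝ (Fin n))).symm.continuous

/-- A segment in a chart all of whose velocities lie in the cone field. -/
theorem isSmoothArc_chart_symm_line {p : M} {y w : EuclideanSpace ℝ (Fin n)} {a b : ℝ}
    (hab : a < b) (h : ∀ s ∈ Icc a b, (y + s • w, w) ∈ chartCone K p) :
    IsSmoothArc K (fun s ↦ (chartAt (EuclideanSpace ℝ (Fin n)) p).symm (y + s • w)) a b := by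
  set e := chartAt (EuclideanSpace ℝ (Fin n)) p
  have hs : ContMDiffOn (𝓡 n) (𝓡 n) ∞ e.symm e.target := contMDiffOn_chart_symm
  have hl : ContMDiff 𝓘(ℝ, ℝ) (𝓡 n) ∞ fun s : ℝ ↦ y + s • w :=
    (contDiff_const.add (contDiff_id.smul contDiff_const)).contMDiff
  refine ⟨hab, hs.comp hl.contMDiffOn fun s hs ↦ (h s hs).1, fun s hst ↦ ?_⟩
  have hd : HasFDerivAt (fun s : ℝ ↦ y + s • w)
      (ContinuousLinearMap.toSpanSingleton ℝ w) s := by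
    have := ((hasDerivAt_id s).smul_const w).const_add y
    simpa using this.hasFDerivAt
  have hd' := hd.hasMFDerivAt
  have he : MDifferentiableAt (𝓡 n) (𝓡 n) e.symm (y + s • w) :=
    (hs.contMDiffAt (e.open_target.mem_nhds (h s hst).1)).mdifferentiableAt (by simp)
  have hc : HasMFDerivWithinAt 𝓘(ℝ, ℝ) (𝓡 n) (fun s : ℝ ↦ e.symm (y + s • w)) (Icc a b) s _ :=
    (he.hasMFDerivAt.comp s hd').hasMFDerivWithinAt
  rw [hc.mfderivWithin ((uniqueDiffOn_Icc hab).uniqueMDiffOn s hst)]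
  convert (h s hst).2 using 1
  change mfderiv (𝓡 n) (𝓡 n) e.symm (y + s • w) ((1 : ℝ) • w) = _
  rw [one_smul]

/-- Points near an interior point of an arc with velocities in an open cone field can be joined
to the neighbouring points of the arc. -/
theorem IsSmoothArc.eventually_isPiecewiseCurve
    (hK : IsOpen {v : TangentBundle (𝓡 n) M | K v.1 v.2}) {γ : ℝ → M} {a b c : ℝ}
    (h : IsSmoothArc K γ a b) (hc : c ∈ Ioo a b) :
    ∀ᶠ t in 𝓝[≠] c, ∀ᶠ x in 𝓝 (γ c), (t < c → ∃ A, IsPiecewiseCurve K (γ t) x A) ∧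
      (c < t → ∃ A, IsPiecewiseCurve K x (γ t) A) := by
  set e := chartAt (EuclideanSpace ℝ (Fin n)) (γ c) with he
  obtain ⟨hab, hγ, hKγ⟩ := h
  have hnhds : Icc a b ∈ 𝓝 c := Icc_mem_nhds hc.1 hc.2
  have hγc : ContMDiffAt 𝓘(ℝ, ℝ) (𝓡 n) ∞ γ c := hγ.contMDiffAt hnhds
  have hsrc : γ c ∈ e.source := mem_chart_source _ _
  have hsrc' : ∀ᶠ t in 𝓝 c, γ t ∈ e.source :=
    hγc.continuousAt (e.open_source.mem_nhds hsrc)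
  have hdγ := hγc.mdifferentiableAt (by simp)
  have hde : MDifferentiableAt (𝓡 n) (𝓡 n) e (γ c) :=
    ((contMDiffOn_chart (I := 𝓡 n) (n := ∞)).contMDiffAt
      (e.open_source.mem_nhds hsrc)).mdifferentiableAt (by simp)
  have hde' : MDifferentiableAt (𝓡 n) (𝓡 n) e.symm (e (γ c)) :=
    ((contMDiffOn_chart_symm (I := 𝓡 n) (n := ∞)).contMDiffAt
      (e.open_target.mem_nhds (e.map_source hsrc))).mdifferentiableAt (by simp)
  have hdg : MDifferentiableAt 𝓘(ℝ, ℝ) (𝓡 n) (e ∘ γ) c := hde.comp c hdγ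
  let L : ℝ →L[ℝ] EuclideanSpace ℝ (Fin n) := mfderiv 𝓘(ℝ, ℝ) (𝓡 n) (e ∘ γ) c
  let u : EuclideanSpace ℝ (Fin n) := L 1
  have hL : HasFDerivAt (e ∘ γ) L c := hasMFDerivAt_iff_hasFDerivAt.1 hdg.hasMFDerivAt
  have hu : HasDerivAt (e ∘ γ) u c := hL.hasDerivAt
  have huK : (e (γ c), u) ∈ chartCone K (γ c) := by
    refine ⟨e.map_source hsrc, ?_⟩
    have h1 : HasMFDerivAt 𝓘(ℝ, ℝ) (𝓡 n) (e.symm ∘ (e ∘ γ)) c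
        ((mfderiv (𝓡 n) (𝓡 n) e.symm (e (γ c))).comp
          (mfderiv 𝓘(ℝ, ℝ) (𝓡 n) (e ∘ γ) c)) :=
      HasMFDerivAt.comp c hde'.hasMFDerivAt hdg.hasMFDerivAt
    have heq : e.symm ∘ (e ∘ γ) =ᶠ[𝓝 c] γ := by
      filter_upwards [hsrc'] with t ht using e.left_inv ht
    have h2 := hKγ c ⟨hc.1.le, hc.2.le⟩
    rw [mfderivWithin_of_mem_nhds hnhds] at h2
    have h3 := h1.congr_of_eventuallyEq heq.symm
    rw [h3.mfderiv] at h2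
    have h4 : e.symm (e (γ c)) = γ c := e.left_inv hsrc
    change K (e.symm (e (γ c))) (mfderiv (𝓡 n) (𝓡 n) e.symm (e (γ c)) u)
    -- The base points agree only propositionally, and `K` depends on the base point.
    have key : ∀ (q : M) (hq : q = γ c) (v : EuclideanSpace ℝ (Fin n)),
        K (γ c) v → K q v := by
      rintro q rfl v hv
      exact hv
    exact key _ h4 _ h2
  -- One radius controls position and velocity: the ball in the product is a product of balls.
  obtain ⟨ε, hε, hball⟩ := Metric.isOpen_iff.1 (isOpen_chartCone hK (γ c)) _ huK
  have hgc : ContinuousAt (e ∘ γ) c := hdg.continuousAt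
  filter_upwards [(hasDerivAt_iff_tendsto_slope.1 hu) (Metric.ball_mem_nhds u hε),
    nhdsWithin_le_nhds (hgc (Metric.ball_mem_nhds _ hε)), nhdsWithin_le_nhds hsrc',
    self_mem_nhdsWithin] with t ht₁ ht₂ ht₃ ht₄
  have htc : c - t ≠ 0 := sub_ne_zero.2 (Ne.symm ht₄)
  have hec : ContinuousAt e (γ c) := e.continuousAt hsrc
  have hw : ContinuousAt (fun x ↦ (c - t)⁻¹ • (e x - e (γ t))) (γ c) :=
    ContinuousAt.const_smul (g := fun x ↦ e x - e (γ t)) (hec.sub continuousAt_const) (c - t)⁻¹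
  have hw₀ : (c - t)⁻¹ • (e (γ c) - e (γ t)) ∈ Metric.ball u ε := by
    rw [← neg_sub t c, inv_neg, neg_smul, ← smul_neg, neg_sub]
    exact ht₁
  filter_upwards [e.open_source.mem_nhds hsrc, hec (Metric.ball_mem_nhds _ hε),
    hw (Metric.isOpen_ball.mem_nhds hw₀)] with x hx₁ hx₂ hx₃
  -- `w` is the velocity of the chart segment at `e (γ t)` at time `t` and at `e x` at time `c`. It
  -- is near `u` as a perturbed difference quotient; convexity of the ball controls the positions.
  set w := (c - t)⁻¹ • (e x - e (γ t)) with hwdef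
  have hwx : (c - t) • w = e x - e (γ t) := smul_inv_smul₀ htc _
  have hlt : (e (γ t) - t • w) + t • w = e (γ t) := sub_add_cancel _ _
  have hlc : (e (γ t) - t • w) + c • w = e x := by
    have : (e (γ t) - t • w) + c • w = e (γ t) + (c - t) • w := by module
    rw [this, hwx]
    abel
  have hcone : ∀ s ∈ uIcc t c, ((e (γ t) - t • w) + s • w, w) ∈ chartCone K (γ c) := by
    intro s hs
    refine hball ?_
    rw [← ball_prod_same]
    refine ⟨?_, hx₃⟩
    rw [← segment_eq_uIcc] at hs
    obtain ⟨α, β, hα, hβ, hαβ, rfl⟩ := hs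
    have : (e (γ t) - t • w) + (α • t + β • c) • w =
        α • ((e (γ t) - t • w) + t • w) + β • ((e (γ t) - t • w) + c • w) := by
      obtain rfl : α = 1 - β := by linarith
      simp only [smul_eq_mul]
      module
    change (e (γ t) - t • w) + (α • t + β • c) • w ∈ _
    rw [this, hlt, hlc]
    exact convex_ball _ _ ht₂ hx₂ hα hβ hαβ
  refine ⟨fun htc ↦ ?_, fun htc ↦ ?_⟩
  · rw [uIcc_of_le htc.le] at hcone
    have := IsPiecewiseCurve.arc _ _ _ (isSmoothArc_chart_symm_line htc hcone)
    simp only [← he, hlt, hlc, e.left_inv ht₃, e.left_inv hx₁] at this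
    exact ⟨_, this⟩
  · rw [uIcc_of_ge htc.le] at hcone
    have := IsPiecewiseCurve.arc _ _ _ (isSmoothArc_chart_symm_line htc hcone)
    simp only [← he, hlt, hlc, e.left_inv ht₃, e.left_inv hx₁] at this
    exact ⟨_, this⟩

/-- The points lying between the end points of a curve in an open cone field have non-empty
interior. -/
theorem IsPiecewiseCurve.exists_isOpen
    (hK : IsOpen {v : TangentBundle (𝓡 n) M | K v.1 v.2}) {p q : M} {A : Set M}
    (h : IsPiecewiseCurve K p q A) : ∃ U : Set M, IsOpen U ∧ U.Nonempty ∧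
      ∀ x ∈ U, (∃ B, IsPiecewiseCurve K p x B) ∧ ∃ B, IsPiecewiseCurve K x q B := by
  induction h with
  | arc γ a b h =>
    -- For t < c < t' near `c`, every point near `γ c` is reached from `γ t` and reaches `γ t'`.
    obtain ⟨c, hc⟩ := exists_between h.1
    have hev := h.eventually_isPiecewiseCurve hK hc
    obtain ⟨t, ht, htc⟩ := ((hev.filter_mono (nhdsLT_le_nhdsNE c)).and
      (Ioo_mem_nhdsLT hc.1)).exists
    obtain ⟨t', ht', htc'⟩ :=
      ((hev.filter_mono (nhdsGT_le_nhdsNE c)).and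
      (Ioo_mem_nhdsGT hc.2)).exists
    obtain ⟨U, hU, hUo, hcU⟩ := eventually_nhds_iff.1 (ht.and ht')
    refine ⟨U, hUo, ⟨_, hcU⟩, fun x hx ↦ ⟨?_, ?_⟩⟩
    · obtain ⟨B, hB⟩ := (hU x hx).1.1 htc.2
      exact ⟨_, .concat _ _ _ _ _
        (.arc γ a t (h.mono le_rfl htc.1 (htc.2.trans hc.2).le)) hB⟩
    · obtain ⟨B, hB⟩ := (hU x hx).2.2 htc'.1
      exact ⟨_, .concat _ _ _ _ _ hB
        (.arc γ t' b (h.mono (hc.1.trans htc'.1).le htc'.2 le_rfl))⟩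
  | concat p q r A B h₁ h₂ ih₁ ih₂ =>
    obtain ⟨U, hUo, hne, hU⟩ := ih₁
    refine ⟨U, hUo, hne, fun x hx ↦ ⟨(hU x hx).1, ?_⟩⟩
    obtain ⟨B', hB'⟩ := (hU x hx).2
    exact ⟨_, .concat _ _ _ _ _ hB' h₂⟩

theorem Spacetime.Chron.trans {S : Spacetime n M} {p q s : M} (h₁ : S.Chron p q)
    (h₂ : S.Chron q s) : S.Chron p s := by
  obtain ⟨A, hA⟩ := h₁
  obtain ⟨B, hB⟩ := h₂
  exact ⟨_, hA.concat _ _ _ _ _ hB⟩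

theorem Spacetime.chronDense_of_dense (S : Spacetime n M) {D : Set M} (hD : Dense D) :
    ChronDense S.Chron D := by
  rintro p q ⟨A, hA⟩
  obtain ⟨U, hUo, hne, hU⟩ := hA.exists_isOpen S.isOpen_isFutureTimelike
  obtain ⟨s, hsU, hsD⟩ := hD.inter_open_nonempty U hUo hne
  exact ⟨s, hsD, hU s hsU⟩

end Geometry

end CausalBoundary

theorem proposition3p38 {n : ℕ} (hn : 2 ≤ n) {M : Type*} [TopologicalSpace M]
    [ChartedSpace (EuclideanSpace ℝ (Fin n)) M] [IsManifold (𝓡 n) ∞ M]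
    [T2Space M] [SecondCountableTopology M]
    (S : Spacetime n M) (hS : S.StronglyCausal) (C : StandardCompletion S)
    (hC : C.Separating) :
    C.FirstOrder ∧ SecondCountableTopology C.Point ∧
      ∀ x : ℕ → M, Dense (range x) → ChronDense S.Chron (range x) →
        Dense (range fun i ↦ C.incl (x i)) ∧
          TopologicalSpace.IsTopologicalBasis (C.basisFamily x) := by
  have htr : ∀ ⦃a b c⦄, S.Chron a b → S.Chron b c → S.Chron a c := fun _ _ _ ↦
    Spacetime.Chron.trans
  refine ⟨hC.firstOrder htr, ?_, fun x _ hx ↦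
    ⟨AdmissibleCompletion.dense_range_incl htr hx, hC.isTopologicalBasis_basisFamily htr hx⟩⟩
  -- A dense sequence exists only for non-empty M. If M is empty so is the completion, since every
  -- pair has a non-empty component.
  rcases isEmpty_or_nonempty M with hM | hM
  · have : IsEmpty C.Point := ⟨fun y ↦ y.pst_ne_empty_or.elim
      (fun h ↦ h (eq_empty_of_isEmpty _)) fun h ↦ h (eq_empty_of_isEmpty _)⟩
    infer_instance
  · exact (hC.isTopologicalBasis_basisFamily htr
      (S.chronDense_of_dense (TopologicalSpace.denseRange_denseSeq M))).secondCountableTopology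
        (AdmissibleCompletion.countable_basisFamily _)
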